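/- Let $G$ be a Polish group. A set $U\subseteq G$ is *universally measurable* if it is measurable with respect to the completion of every Borel probability measure on $G$. A set $X\subseteq G$ is - *Haar null* if there are a universally measurable set $U\supseteq X$ and a Borel probability measure $\mu$ on $G$ with $\mu(gUh)=0$ for all $g,h\in G$; - *naively Haar null* if there is a Borel probability measure $\mu$ on $G$ with $\mu(gXh)=0$ for all $g,h\in G$; - *naively left Haar null* if there is a Borel probability measure $\mu$ on $G$ with $\mu(gX)=0$ for all $g\in G$. Here Borel measures are identified with their completions, so that $\mu(A)=0$ means that $A$ has outer $\mu$-measure zero. A *partial left transversal* to a subgroup $H$ is a set meeting every left coset $gH$ in at most one point. **Theorem.** Let $G$ be an uncountable locally compact Polish group. Then there exist a Borel subgroup $H\le G$, uncountable and of uncountable index, and a partial left transversal $X\subseteq G$ to $H$ such that $X$ is naively left Haar null, but $X$ is not Haar null and has non-zero outer measure with respect to every left Haar measure on $G$. In particular, if $G$ is in addition abelian, then there exist such $H$ and $X$ with $X$ naively Haar null, but not Haar null and of non-zero outer measure with respect to every Haar measure on $G$. -/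

import Mathlib

open MeasureTheory

/-- A set is universally measurable if it is measurable with respect to (the completion of) every
Borel probability measure. -/
def UniversallyMeasurable {G : Type*} [MeasurableSpace G] (U : Set G) : Prop :=
  ∀ μ : Measure G, IsProbabilityMeasure μ → NullMeasurableSet U μ

/-- Haar null sets in the sense of Christensen: some universally measurable hull `U` of `X` has all
its two-sided translates `gUh` null for one Borel probability measure. -/
def HaarNull {G : Type*} [Group G] [MeasurableSpace G] (X : Set G) : Prop :=
  ∃ U : Set G, UniversallyMeasurable U ∧ X ⊆ U ∧
    ∃ μ : Measure G, IsProbabilityMeasure μ ∧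
      ∀ g h : G, μ ((fun x => g * x * h) '' U) = 0

/-- Naively Haar null sets: no hull is required. The value of a measure at an arbitrary set is its
outer measure, so `μ A = 0` says that `A` is null for the completion of `μ`. -/
def NaivelyHaarNull {G : Type*} [Group G] [MeasurableSpace G] (X : Set G) : Prop :=
  ∃ μ : Measure G, IsProbabilityMeasure μ ∧
    ∀ g h : G, μ ((fun x => g * x * h) '' X) = 0

/-- Naively left Haar null sets: only the left translates `gX` are required to be null. -/
def NaivelyLeftHaarNull {G : Type*} [Group G] [MeasurableSpace G] (X : Set G) : Prop :=
  ∃ μ : Measure G, IsProbabilityMeasure μ ∧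
    ∀ g : G, μ ((fun x => g * x) '' X) = 0

/-- A partial left transversal to `H` meets every left coset `gH` in at most one point. -/
def IsPartialLeftTransversal {G : Type*} [Group G] (H : Subgroup G) (X : Set G) : Prop :=
  ∀ g : G, (X ∩ (fun x => g * x) '' (H : Set G)).Subsingleton

/-! Let H be the union of the powers of a compact symmetric Cantor-type set S containing 1, built so
that every S ^ n is Haar null. Then H is an uncountable σ-compact null subgroup, and a
Mycielski-type argument (`exists_injective_mk_mem`) shows that every Borel set of positive Haar
measure meets continuum many left cosets of H. There are at most continuum many such Borel sets, so
one point of each can be chosen with all points in different cosets; these points form X. Each gX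
meets H in at most one point, so an atomless probability measure living on H makes X naively left
Haar null. But X meets every Borel set of positive measure, so it has positive outer measure and
every universally measurable hull of it is conull; Fubini then shows that no such hull is Haar null.
In the abelian case gXh = (gh)X. -/

open Set Filter Topology PiNat
open scoped Pointwise

/-! ### Cantor schemes and fusion -/

/-- In a metric space, a nonempty open set without isolated points contains two small disjoint
nonempty open sets whose closures stay inside. -/
theorem exists_disjoint_open_pair {X : Type*} [MetricSpace X] (hX : ∀ x : X, (𝓝[≠] x).NeBot)
    {W : Set X} (hW : IsOpen W) (hne : W.Nonempty) {ε : ℝ} (hε : 0 < ε) :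
    ∃ U : Bool → Set X, (∀ b, IsOpen (U b) ∧ (U b).Nonempty) ∧ (∀ b, closure (U b) ⊆ W) ∧
      (∀ b, Metric.ediam (U b) ≤ ENNReal.ofReal ε) ∧
      Pairwise fun a b => Disjoint (U a) (U b) := by
  obtain ⟨x, hx⟩ := hne
  obtain ⟨y, hy, hyx⟩ : ∃ y ∈ W, y ≠ x := by
    have := hX x
    obtain ⟨y, hy⟩ := Filter.nonempty_of_mem
      (inter_mem (mem_nhdsWithin_of_mem_nhds (hW.mem_nhds hx)) (self_mem_nhdsWithin (s := {x}ᶜ)))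
    exact ⟨y, hy.1, hy.2⟩
  obtain ⟨r₁, hr₁, h₁⟩ := Metric.nhds_basis_closedBall.mem_iff.1 (hW.mem_nhds hx)
  obtain ⟨r₂, hr₂, h₂⟩ := Metric.nhds_basis_closedBall.mem_iff.1 (hW.mem_nhds hy)
  have hd : 0 < dist y x := dist_pos.2 hyx
  obtain ⟨r, hr, hr'⟩ : ∃ r : ℝ, 0 < r ∧ r ≤ r₁ ∧ r ≤ r₂ ∧ r ≤ ε / 2 ∧ r ≤ dist y x / 2 :=
    ⟨min (min r₁ r₂) (min (ε / 2) (dist y x / 2)), by positivity, by simp⟩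
  have hdisj : Disjoint (Metric.ball y r) (Metric.ball x r) :=
    Metric.ball_disjoint_ball (by linarith)
  refine ⟨fun b => Metric.ball (if b then x else y) r,
    fun b => ⟨Metric.isOpen_ball, _, Metric.mem_ball_self hr⟩, fun b => ?_, fun b => ?_, ?_⟩
  · refine Metric.closure_ball_subset_closedBall.trans ?_
    cases b
    · exact (Metric.closedBall_subset_closedBall hr'.2.1).trans h₂
    · exact (Metric.closedBall_subset_closedBall hr'.1).trans h₁
  · refine Metric.ediam_le fun p hp q hq => ?_
    rw [edist_dist]
    refine ENNReal.ofReal_le_ofReal ?_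
    rw [Metric.mem_ball] at hp hq
    linarith [dist_triangle_right p q (if b then x else y)]
  · rintro (_ | _) (_ | _) h
    · exact absurd rfl h
    · simpa using hdisj
    · simpa using hdisj.symm
    · exact absurd rfl h

/-- Fusion: if countably many requirements on families of open sets can each be met by shrinking,
then a perfect complete metric space contains a Cantor set meeting all of them. -/
theorem exists_continuous_injective_cantor {X : Type*} [MetricSpace X] [CompleteSpace X]
    [Nonempty X] (hX : ∀ x : X, (𝓝[≠] x).NeBot) (Q : ℕ → (List Bool → Set X) → Prop)
    (hQ : ∀ (n : ℕ) (U : List Bool → Set X), (∀ l, IsOpen (U l) ∧ (U l).Nonempty) →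
      ∃ V, (∀ l, IsOpen (V l) ∧ (V l).Nonempty) ∧ (∀ l, V l ⊆ U l) ∧ Q n V) :
    ∃ F : (ℕ → Bool) → X, Continuous F ∧ Function.Injective F ∧
      ∀ n, ∃ V, Q n V ∧ ∀ x, F x ∈ V (res x n) := by
  let Good := {V : List Bool → Set X // ∀ l, IsOpen (V l) ∧ (V l).Nonempty}
  have step : ∀ (n : ℕ) (V : Good), ∃ V' : Good, Q (n + 1) V'.1 ∧
      (∀ l b, closure (V'.1 (b :: l)) ⊆ V.1 l) ∧
      (∀ l b, Metric.ediam (V'.1 (b :: l)) ≤ ENNReal.ofReal ((1 / 2 : ℝ) ^ n)) ∧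
      ∀ l, Pairwise fun a b => Disjoint (V'.1 (a :: l)) (V'.1 (b :: l)) := by
    intro n V
    choose U hU hcl hdiam hdisj using fun l => exists_disjoint_open_pair hX (V.2 l).1 (V.2 l).2
      (ε := (1 / 2 : ℝ) ^ n) (by positivity)
    -- The value at the empty word is a dummy: this family is only read at words of length `n + 1`.
    let U' : List Bool → Set X := fun l => match l with
      | [] => univ
      | b :: l => U l b
    obtain ⟨V', hV', hle, hq⟩ := hQ (n + 1) U' (by
      rintro (_ | ⟨b, l⟩)
      · exact ⟨isOpen_univ, univ_nonempty⟩
      · exact hU l b)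
    refine ⟨⟨V', hV'⟩, hq, fun l b => (closure_mono (hle (b :: l))).trans (hcl l b),
      fun l b => (Metric.ediam_mono (hle (b :: l))).trans (hdiam l b),
      fun l a b hab => (hdisj l hab).mono (hle (a :: l)) (hle (b :: l))⟩
  choose next hnextQ hnextcl hnextdiam hnextdisj using step
  obtain ⟨V₀, hV₀, -, hQ₀⟩ := hQ 0 (fun _ => univ) fun _ => ⟨isOpen_univ, univ_nonempty⟩
  let V : ℕ → Good := fun n => Nat.rec ⟨V₀, hV₀⟩ next n
  -- The scheme is diagonal: a word of length n is read in the n-th family, where the requirement `Q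
  -- n` holds.
  let A : List Bool → Set X := fun l => (V l.length).1 l
  have hA : ∀ x n, A (res x n) = (V n).1 (res x n) := fun x n => by
    simp only [A, res_length]
  have hdiam : CantorScheme.VanishingDiam A := by
    intro x
    rw [← tendsto_add_atTop_iff_nat 1]
    refine tendsto_of_tendsto_of_tendsto_of_le_of_le tendsto_const_nhds
      (h := fun n : ℕ => ENNReal.ofReal ((1 / 2 : ℝ) ^ n)) ?_ (fun _ => zero_le) fun n => ?_
    · rw [← ENNReal.ofReal_zero]
      exact ENNReal.tendsto_ofReal
        (tendsto_pow_atTop_nhds_zero_of_lt_one (by norm_num) (by norm_num))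
    · rw [hA]
      exact hnextdiam n (V n) (res x n) (x n)
  have hcl : CantorScheme.ClosureAntitone A := fun l b => hnextcl l.length (V l.length) l b
  have hdisj : CantorScheme.Disjoint A := fun l => hnextdisj l.length (V l.length) l
  have huniv := hcl.map_of_vanishingDiam hdiam fun l => ((V l.length).2 l).2
  have hmem : ∀ x, x ∈ (CantorScheme.inducedMap A).1 := fun x => huniv ▸ mem_univ x
  refine ⟨fun x => (CantorScheme.inducedMap A).2 ⟨x, hmem x⟩,
    hdiam.map_continuous.comp (by fun_prop), fun x y h =>
    congrArg Subtype.val (hdisj.map_injective h), fun n => ⟨(V n).1, ?_, fun x => ?_⟩⟩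
  · cases n with
    | zero => exact hQ₀
    | succ n => exact hnextQ n (V n)
  · rw [← hA]
    exact CantorScheme.map_mem (A := A) ⟨x, hmem x⟩ n

/-- A family of open sets can be shrunk so as to avoid a relation between any two distinct members
of a finite subfamily, provided this is possible for two open sets. -/
theorem exists_open_family_avoiding {X ι : Type*} [TopologicalSpace X] {R : X → X → Prop}
    (hR : ∀ A B : Set X, IsOpen A → A.Nonempty → IsOpen B → B.Nonempty →
      ∃ A' ⊆ A, ∃ B' ⊆ B, (IsOpen A' ∧ A'.Nonempty) ∧ (IsOpen B' ∧ B'.Nonempty) ∧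
        ∀ a ∈ A', ∀ b ∈ B', ¬ R a b)
    {T : Set (ι × ι)} (hT : T.Finite) (hoff : ∀ p ∈ T, p.1 ≠ p.2) (U : ι → Set X)
    (hU : ∀ i, IsOpen (U i) ∧ (U i).Nonempty) :
    ∃ V : ι → Set X, (∀ i, IsOpen (V i) ∧ (V i).Nonempty) ∧ (∀ i, V i ⊆ U i) ∧
      ∀ p ∈ T, ∀ a ∈ V p.1, ∀ b ∈ V p.2, ¬ R a b := by
  classical
  induction T, hT using Set.Finite.induction_on with
  | empty => exact ⟨U, hU, fun _ => subset_rfl, by simp⟩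
  | @insert p T hp hT ih =>
    obtain ⟨V, hV, hVU, hVT⟩ := ih fun q hq => hoff q (mem_insert_of_mem _ hq)
    obtain ⟨A, hA, B, hB, hA', hB', hAB⟩ :=
      hR _ _ (hV p.1).1 (hV p.1).2 (hV p.2).1 (hV p.2).2
    have hne : p.1 ≠ p.2 := hoff p (mem_insert _ _)
    let V' := Function.update (Function.update V p.1 A) p.2 B
    have h1 : V' p.1 = A := by simp [V', hne]
    have h2 : V' p.2 = B := by simp [V']
    have h3 : ∀ i, i ≠ p.1 → i ≠ p.2 → V' i = V i := fun i hi hi' => by simp [V', hi, hi']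
    have hV'V : ∀ i, V' i ⊆ V i := by
      intro i
      by_cases hi : i = p.1
      · rw [hi, h1]; exact hA
      by_cases hi' : i = p.2
      · rw [hi', h2]; exact hB
      rw [h3 i hi hi']
    refine ⟨V', fun i => ?_, fun i => (hV'V i).trans (hVU i), ?_⟩
    · by_cases hi : i = p.1
      · rw [hi, h1]; exact hA'
      by_cases hi' : i = p.2
      · rw [hi', h2]; exact hB'
      rw [h3 i hi hi']; exact hV i
    · rintro q (rfl | hq) a ha b hb
      · exact hAB a (h1 ▸ ha) b (h2 ▸ hb)
      · exact hVT q hq a (hV'V _ ha) b (hV'V _ hb)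

/-! ### Distinct representatives -/

/-- If every `A i` has at least as many elements as the index type, the family `A` has a system of
distinct representatives. -/
theorem exists_injective_mem_of_mk_le {ι Y : Type*} {A : ι → Set Y}
    (hA : ∀ i, Nonempty (ι ↪ A i)) :
    ∃ f : ι → Y, Function.Injective f ∧ ∀ i, f i ∈ A i := by
  classical
  -- In a well-order of minimal type every proper initial segment is smaller than ι, so the earlier
  -- choices cannot exhaust `A i`.
  obtain ⟨r, hr, hord⟩ := Cardinal.exists_ord_eq ι
  have key : ∀ (i : ι) (f : ∀ j, r j i → Y), ∃ y ∈ A i, ∀ j hj, f j hj ≠ y := by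
    intro i f
    by_contra! hcon
    choose g hg hfg using hcon
    obtain ⟨e⟩ := hA i
    have hlt : Cardinal.mk {j // r j i} < Cardinal.mk ι :=
      Ordinal.card_typein (r := r) i ▸ Cardinal.card_typein_lt i hord
    refine hlt.not_ge (Cardinal.mk_le_of_injective
      (f := fun k : ι => (⟨g (e k) (e k).2, hg _ _⟩ : {j // r j i})) fun k l hkl => ?_)
    have h : g (e k) (e k).2 = g (e l) (e l).2 := congrArg Subtype.val hkl
    refine e.injective (Subtype.ext ?_)
    rw [← hfg _ (e k).2, ← hfg _ (e l).2]
    congr 1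
  choose pick hpick hpick' using key
  let f : ι → Y := hr.wf.fix fun i f => pick i f
  have hf : ∀ i, f i = pick i fun j _ => f j := fun i => hr.wf.fix_eq _ i
  have hne : ∀ i j, r j i → f j ≠ f i := fun i j hij => by
    rw [hf i]
    exact hpick' i (fun j _ => f j) j hij
  refine ⟨f, fun i j hij => ?_, fun i => ?_⟩
  · rcases trichotomous_of r i j with h | h | h
    · exact absurd hij (hne j i h)
    · exact h
    · exact absurd hij.symm (hne i j h)
  · rw [hf i]
    exact hpick _ _

/-! ### An uncountable σ-compact null subgroup -/

theorem IsCompact.setPow {G : Type*} [Monoid G] [TopologicalSpace G] [ContinuousMul G] {K : Set G}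
    (hK : IsCompact K) (n : ℕ) : IsCompact (K ^ n) := by
  induction n with
  | zero => simp
  | succ n ih => exact pow_succ K n ▸ ih.mul hK

theorem Set.Finite.setPow {G : Type*} [Monoid G] {K : Set G} (hK : K.Finite) (n : ℕ) :
    (K ^ n).Finite := by
  induction n with
  | zero => simp
  | succ n ih => exact pow_succ K n ▸ ih.mul hK

/-- A compact set whose `n`-th power lies in an open set has an open neighbourhood with the same
property. -/
theorem IsCompact.exists_isOpen_pow_subset {G : Type*} [Monoid G] [TopologicalSpace G]
    [ContinuousMul G] {K : Set G} (hK : IsCompact K) (n : ℕ) {O : Set G} (hO : IsOpen O)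
    (h : K ^ n ⊆ O) : ∃ A, IsOpen A ∧ K ⊆ A ∧ A ^ n ⊆ O := by
  induction n generalizing O with
  | zero => exact ⟨univ, isOpen_univ, subset_univ _, by simpa using h⟩
  | succ n ih =>
    obtain ⟨A, B, hA, hB, hKA, hKB, hAB⟩ := generalized_tube_lemma hK (hK.setPow n)
      (hO.preimage continuous_mul) (by
        rintro ⟨a, b⟩ ⟨ha, hb⟩
        exact h (pow_succ' K n ▸ mul_mem_mul ha hb))
    obtain ⟨A', hA', hKA', hA'B⟩ := ih hB hKB
    refine ⟨A ∩ A', hA.inter hA', subset_inter hKA hKA', ?_⟩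
    rw [pow_succ']
    rintro _ ⟨a, ha, b, hb, rfl⟩
    exact hAB (mk_mem_prod ha.1 (hA'B (pow_subset_pow_left inter_subset_right hb)))

/-- In a perfect Polish group, there is an uncountable compact symmetric set all of whose powers
are null for a given atomless outer regular measure. -/
theorem exists_isCompact_uncountable_measure_pow_eq_zero {G : Type*} [Group G]
    [TopologicalSpace G] [IsTopologicalGroup G] [PolishSpace G] [MeasurableSpace G]
    (hG : ∀ x : G, (𝓝[≠] x).NeBot) (μ : Measure G) [μ.OuterRegular] [NullSingletonClass μ] :
    ∃ S : Set G, IsCompact S ∧ 1 ∈ S ∧ S⁻¹ = S ∧ ¬ S.Countable ∧ ∀ n : ℕ, μ (S ^ n) = 0 := by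
  let := TopologicalSpace.upgradeIsCompletelyMetrizable G
  -- Including 1 makes the powers increase with the exponent.
  let W : Set G → Set G := fun A => A ∪ A⁻¹ ∪ {1}
  have hWmono : ∀ {A B : Set G}, A ⊆ B → W A ⊆ W B := fun h =>
    union_subset_union_left _ (union_subset_union h (inv_subset_inv.2 h))
  have hW1 : ∀ A, (1 : G) ∈ W A := fun A => Or.inr rfl
  obtain ⟨F, hFc, hFi, hF⟩ := exists_continuous_injective_cantor hG
    (fun n V => μ (W (⋃ l ∈ {l : List Bool | l.length = n}, V l) ^ n) < ((n : ENNReal) + 1)⁻¹) (by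
      intro n U hU
      -- One point per word of length n gives a finite set, whose n-th power is finite, hence null;
      -- outer regularity and compactness then thicken it to open sets at small cost.
      choose p hp using fun l => (hU l).2
      have hfin : (W (⋃ l ∈ {l : List Bool | l.length = n}, {p l})).Finite := by
        have : (⋃ l ∈ {l : List Bool | l.length = n}, ({p l} : Set G)).Finite :=
          (List.finite_length_eq Bool n).biUnion fun _ _ => finite_singleton _
        exact (this.union this.inv).union (finite_singleton _)
      obtain ⟨O, hO, hOo, hμ⟩ := Set.exists_isOpen_lt_of_lt (μ := μ) _ ((n : ENNReal) + 1)⁻¹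
        (by rw [(hfin.setPow n).measure_zero μ]; simp)
      obtain ⟨A, hA, hKA, hAO⟩ := hfin.isCompact.exists_isOpen_pow_subset n hOo hO
      refine ⟨fun l => if l.length = n then U l ∩ (A ∩ A⁻¹) else U l, fun l => ?_, fun l => ?_, ?_⟩
      · dsimp only
        split_ifs with hl
        · have hpl : p l ∈ ⋃ l ∈ {l : List Bool | l.length = n}, ({p l} : Set G) :=
            mem_biUnion (x := l) hl rfl
          exact ⟨(hU l).1.inter (hA.inter hA.inv), p l, hp l, hKA (Or.inl (Or.inl hpl)),
            hKA (Or.inl (Or.inr (Set.inv_mem_inv.2 hpl)))⟩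
        · exact hU l
      · dsimp only
        split_ifs
        · exact inter_subset_left
        · exact subset_rfl
      · refine (measure_mono ((pow_subset_pow_left ?_).trans hAO)).trans_lt hμ
        have hsub : (⋃ l ∈ {l : List Bool | l.length = n},
            (if l.length = n then U l ∩ (A ∩ A⁻¹) else U l)) ⊆ A ∩ A⁻¹ := by
          refine iUnion₂_subset fun l hl => ?_
          rw [if_pos (by exact hl)]
          exact inter_subset_right
        refine union_subset (union_subset (hsub.trans inter_subset_left) ?_)
          (singleton_subset_iff.2 (hKA (hW1 _)))
        rw [inv_subset]
        exact hsub.trans inter_subset_right)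
  have hmono : ∀ {m n : ℕ}, m ≤ n → W (range F) ^ m ⊆ W (range F) ^ n := fun h =>
    pow_subset_pow_right (hW1 _) h
  have hsmall : ∀ n : ℕ, μ (W (range F) ^ n) ≤ ((n : ENNReal) + 1)⁻¹ := by
    intro n
    obtain ⟨V, hV, hFV⟩ := hF n
    refine (measure_mono (pow_subset_pow_left (hWmono ?_))).trans hV.le
    rintro _ ⟨x, rfl⟩
    exact mem_biUnion (x := res x n) (res_length x n) (hFV x)
  have hc : IsCompact (range F) := isCompact_range hFc
  refine ⟨W (range F), (hc.union hc.inv).union isCompact_singleton, hW1 _, ?_, fun h => ?_,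
    fun n => ?_⟩
  · simp only [W, union_inv, inv_inv, inv_singleton, inv_one, union_comm]
  · have : (range F).Countable := h.mono (subset_union_left.trans subset_union_left)
    rw [← image_univ] at this
    have h2 := countable_of_injective_of_countable_image hFi.injOn this
    rw [countable_univ_iff] at h2
    have := Cardinal.mk_le_aleph0_iff.2 h2
    simp only [Cardinal.mk_pi, Cardinal.mk_fintype, Fintype.card_bool, Nat.cast_ofNat,
      Cardinal.prod_const, Cardinal.mk_nat, Cardinal.lift_ofNat, Cardinal.lift_aleph0] at this
    exact (Cardinal.cantor _).not_ge this
  -- For m ≥ n the n-th power lies in the m-th, of measure at most 1 / (m + 1).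
  · refine nonpos_iff_eq_zero.1 (ge_of_tendsto
      ((tendsto_add_atTop_iff_nat 1).2 ENNReal.tendsto_inv_nat_nhds_zero)
      (eventually_atTop.2 ⟨n, fun m hm => ?_⟩))
    rw [Nat.cast_succ]
    exact (measure_mono (hmono hm)).trans (hsmall m)

/-- The subgroup generated by a symmetric set containing the identity, as the union of its
powers. -/
def Subgroup.iUnionPow {G : Type*} [Group G] (S : Set G) (hinv : S⁻¹ = S) : Subgroup G where
  carrier := ⋃ n : ℕ, S ^ n
  one_mem' := mem_iUnion.2 ⟨0, by simp⟩
  mul_mem' ha hb := by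
    obtain ⟨m, hm⟩ := mem_iUnion.1 ha
    obtain ⟨n, hn⟩ := mem_iUnion.1 hb
    exact mem_iUnion.2 ⟨m + n, pow_add S m n ▸ mul_mem_mul hm hn⟩
  inv_mem' ha := by
    obtain ⟨m, hm⟩ := mem_iUnion.1 ha
    refine mem_iUnion.2 ⟨m, ?_⟩
    rwa [← hinv, inv_pow, Set.inv_mem_inv]

/-! ### Perfectly many cosets in a set of positive measure -/

/-- A set of positive measure contains continuum many points that are pairwise inequivalent modulo
a null subgroup which is a countable union of powers of a compact set. -/
theorem exists_injective_mk_mem {G : Type*} [Group G]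
    [TopologicalSpace G] [IsTopologicalGroup G] [PolishSpace G] [MeasurableSpace G] [BorelSpace G]
    (μ : Measure G) [μ.InnerRegularCompactLTTop] [SigmaFinite μ] [μ.IsMulLeftInvariant]
    [NullSingletonClass μ] {S : Set G} (hSc : IsCompact S) (h1 : 1 ∈ S) (hinv : S⁻¹ = S)
    (hS : ∀ n : ℕ, μ (S ^ n) = 0) {B : Set G} (hB : MeasurableSet B) (hμB : μ B ≠ 0) :
    ∃ F : (ℕ → Bool) → B,
      Function.Injective fun x => ((F x : G) : G ⧸ Subgroup.iUnionPow S hinv) := by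
  obtain ⟨K₀, hK₀B, hK₀, hμK₀, hμK₀top⟩ : ∃ K ⊆ B, IsCompact K ∧ μ K ≠ 0 ∧ μ K ≠ ⊤ := by
    obtain ⟨B', hB'B, hB', hpos, htop⟩ : ∃ B' ⊆ B, MeasurableSet B' ∧ 0 < μ B' ∧ μ B' < ⊤ := by
      exact Measure.exists_subset_measure_lt_top hB (pos_iff_ne_zero.2 hμB) |>.imp fun t ht =>
        ⟨ht.2.1, ht.1, ht.2.2⟩
    obtain ⟨K, hK, hKc, hμK⟩ := hB'.exists_lt_isCompact_of_ne_top htop.ne hpos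
    exact ⟨K, hK.trans hB'B, hKc, hμK.ne', ((measure_mono hK).trans_lt htop).ne⟩
  -- After this trimming, nonempty relatively open subsets of K have positive measure. Hence K is
  -- perfect, and no such subset fits inside a translate of the null set `S ^ n`.
  set K := μ.everywherePosSubset K₀ with hKdef
  have hK : IsCompact K := hK₀.everywherePosSubset
  have hKpos : μ.IsEverywherePos K :=
    Measure.isEverywherePos_everywherePosSubset_of_measure_ne_top hK₀.measurableSet hμK₀top
  have hμK : μ K ≠ 0 := by
    rwa [measure_congr (Measure.everywherePosSubset_ae_eq_of_measure_ne_top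
      hK₀.measurableSet hμK₀top)]
  have hKB : K ⊆ B := (Measure.everywherePosSubset_subset μ K₀).trans hK₀B
  have hpos : ∀ O : Set K, IsOpen O → O.Nonempty → μ ((↑) '' O) ≠ 0 := by
    intro O hO ⟨x, hx⟩
    refine (hKpos x x.2 _ ?_).ne'
    rw [nhdsWithin_eq_map_subtype_coe x.2]
    exact image_mem_map (hO.mem_nhds hx)
  let := TopologicalSpace.upgradeIsCompletelyMetrizable G
  have : CompactSpace K := isCompact_iff_compactSpace.1 hK
  have : Nonempty K := by
    by_contra h
    rw [nonempty_coe_sort, not_nonempty_iff_eq_empty] at h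
    simp [h] at hμK
  have hperf : ∀ x : K, (𝓝[≠] x).NeBot := by
    intro x
    rw [← mem_closure_iff_nhdsWithin_neBot, mem_closure_iff]
    intro O hO hx
    by_contra h
    have hOx : O ⊆ {x} := fun y hy => by_contra fun hyx => h ⟨y, hy, hyx⟩
    refine hpos O hO ⟨x, hx⟩ (measure_mono_null (image_mono hOx) ?_)
    simp
  obtain ⟨F, hFc, hFi, hF⟩ := exists_continuous_injective_cantor hperf
    (fun n V => ∀ p ∈ {p : List Bool × List Bool | p.1.length = n ∧ p.2.length = n ∧ p.1 ≠ p.2},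
      ∀ a ∈ V p.1, ∀ b ∈ V p.2, ¬ (a : G)⁻¹ * b ∈ S ^ n) (by
      intro n U hU
      refine exists_open_family_avoiding (R := fun a b : K => (a : G)⁻¹ * b ∈ S ^ n)
        (fun A A' hA ⟨a, ha⟩ hA' hne => ?_) ?_ (fun p hp => hp.2.2) U hU
      · obtain ⟨b, hb, hab⟩ : ∃ b ∈ A', ¬ (a : G)⁻¹ * b ∈ S ^ n := by
          by_contra! hcon
          refine hpos A' hA' hne (measure_mono_null (t := (fun x => (a : G)⁻¹ * x) ⁻¹' (S ^ n)) ?_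
            ((measure_preimage_mul μ _ _).trans (hS n)))
          rintro _ ⟨b, hb, rfl⟩
          exact hcon b hb
        -- Since `S ^ n` is closed, avoiding it at one pair (a, b) persists on neighbourhoods.
        have hopen : IsOpen {q : K × K | ¬ (q.1 : G)⁻¹ * q.2 ∈ S ^ n} :=
          (hSc.setPow n).isClosed.isOpen_compl.preimage
            (f := fun q : K × K => (q.1 : G)⁻¹ * q.2) (by fun_prop)
        obtain ⟨V, V', hV, hV', haV, hbV', hVV'⟩ := isOpen_prod_iff.1 hopen a b hab
        exact ⟨A ∩ V, inter_subset_left, A' ∩ V', inter_subset_left, ⟨hA.inter hV, a, ha, haV⟩,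
          ⟨hA'.inter hV', b, hb, hbV'⟩, fun x hx y hy => hVV' (mk_mem_prod hx.2 hy.2)⟩
      · refine ((List.finite_length_eq Bool n).prod (List.finite_length_eq Bool n)).subset ?_
        exact fun p hp => ⟨hp.1, hp.2.1⟩)
  refine ⟨fun x => ⟨F x, hKB (F x).2⟩, fun x y hxy => ?_⟩
  by_contra hne
  obtain ⟨m, hm⟩ := mem_iUnion.1 (QuotientGroup.eq.1 hxy : (F x : G)⁻¹ * F y ∈ ⋃ n : ℕ, S ^ n)
  obtain ⟨k, hk⟩ := Function.ne_iff.1 hne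
  -- At this level x and y already have different prefixes, and `S ^ m` is contained in the power
  -- avoided there.
  obtain ⟨V, hV, hFV⟩ := hF (max m (k + 1))
  refine hV (res x _, res y _) ⟨res_length _ _, res_length _ _, fun h => ?_⟩ _ (hFV x) _ (hFV y)
    (pow_subset_pow_right h1 (le_max_left _ _) hm)
  exact hk (res_eq_res.1 h (lt_of_lt_of_le k.lt_succ_self (le_max_right _ _)))

/-! ### Haar null versus naively left Haar null -/

/-- A set that meets every measurable set of positive Haar measure is not Haar null. -/
theorem not_haarNull_of_forall_inter_nonempty {G : Type*} [Group G] [MeasurableSpace G]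
    [MeasurableMul₂ G] [MeasurableInv G] (μ : Measure G) [SigmaFinite μ] [μ.IsMulLeftInvariant]
    [NeZero μ] {X : Set G} (hX : ∀ B, MeasurableSet B → μ B ≠ 0 → (X ∩ B).Nonempty) :
    ¬ HaarNull X := by
  rintro ⟨U, hU, hXU, ν, hν, hνU⟩
  -- `μ.toFinite` is a probability measure with the same null sets as μ.
  have hUμ : NullMeasurableSet U μ :=
    (hU μ.toFinite inferInstance).mono_ac (absolutelyContinuous_toFinite μ)
  have hUc : μ Uᶜ = 0 := by
    obtain ⟨T, hTU, hT, hTae⟩ := hUμ.compl.exists_measurable_subset_ae_eq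
    by_contra h
    obtain ⟨x, hxX, hxT⟩ := hX T hT (by rwa [measure_congr hTae])
    exact hTU hxT (hXU hxX)
  set B := toMeasurable μ Uᶜ
  have hB : MeasurableSet B := measurableSet_toMeasurable _ _
  have hμB : μ B = 0 := by rw [measure_toMeasurable, hUc]
  have hE : MeasurableSet {p : G × G | p.1⁻¹ * p.2 ∈ B} :=
    (measurable_fst.inv.mul measurable_snd) hB
  -- For fixed x the section in g is xB⁻¹, which is μ-null because inversion preserves null sets. So
  -- gB is ν-null for some g, while gB and gU cover G.
  have hprod : μ.prod ν {p : G × G | p.1⁻¹ * p.2 ∈ B} = 0 := by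
    rw [Measure.prod_apply_symm hE]
    refine lintegral_eq_zero_of_ae_eq_zero (Eventually.of_forall fun x => ?_)
    have : (fun g => (g, x)) ⁻¹' {p : G × G | p.1⁻¹ * p.2 ∈ B} = (fun g => x⁻¹ * g) ⁻¹' B⁻¹ := by
      ext g
      simp
    dsimp only
    rw [this, measure_preimage_mul, Pi.zero_apply, measure_inv_null, hμB]
  obtain ⟨g, hg⟩ := ((Measure.measure_prod_null hE).1 hprod).exists
  have hcover : (univ : Set G) ⊆
      Prod.mk g ⁻¹' {p : G × G | p.1⁻¹ * p.2 ∈ B} ∪ (fun x => g * x * 1) '' U := by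
    intro x _
    by_cases hx : g⁻¹ * x ∈ B
    · exact Or.inl hx
    · exact Or.inr ⟨g⁻¹ * x, not_not.1 fun h => hx (subset_toMeasurable _ _ h), by simp⟩
  have := measure_mono_null hcover (measure_union_null hg (hνU g 1))
  simp at this

/-- A partial left transversal to an uncountable measurable subgroup is naively left Haar null. -/
theorem IsPartialLeftTransversal.naivelyLeftHaarNull {G : Type*} [Group G] [MeasurableSpace G]
    [StandardBorelSpace G] {H : Subgroup G} (hH : MeasurableSet (H : Set G)) [Uncountable H]
    {X : Set G} (hX : IsPartialLeftTransversal H X) : NaivelyLeftHaarNull X := by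
  have : StandardBorelSpace H := hH.standardBorel
  -- A Borel isomorphism with the line transports a Gaussian, used only as an atomless probability
  -- measure, to H.
  let e : ℝ ≃ᵐ H := PolishSpace.measurableEquivOfNotCountable
    (not_countable_iff.2 inferInstance) (not_countable_iff.2 inferInstance)
  have hf : Measurable fun t => (e t : G) := measurable_subtype_coe.comp e.measurable
  refine ⟨(ProbabilityTheory.gaussianReal 0 1).map fun t => (e t : G),
    Measure.isProbabilityMeasure_map hf.aemeasurable, fun g => ?_⟩
  have := ProbabilityTheory.nullSingletonClass_gaussianReal (μ := 0) (v := 1) one_ne_zero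
  have hsub : ((fun x => g * x) '' X ∩ H).Subsingleton := by
    rintro _ ⟨⟨x, hx, rfl⟩, hxH⟩ _ ⟨⟨y, hy, rfl⟩, hyH⟩
    exact congrArg (g * ·) (hX g⁻¹ ⟨hx, g * x, hxH, by simp⟩ ⟨hy, g * y, hyH, by simp⟩)
  refine measure_mono_null (t := ((fun x => g * x) '' X ∩ H) ∪ (H : Set G)ᶜ) (fun x hx => ?_)
    (measure_union_null ?_ ?_)
  · by_cases h : x ∈ (H : Set G)
    · exact Or.inl ⟨hx, h⟩
    · exact Or.inr h
  · rw [Measure.map_apply hf hsub.measurableSet]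
    exact (hsub.preimage (Subtype.val_injective.comp e.injective)).measure_zero _
  · rw [Measure.map_apply hf hH.compl]
    convert measure_empty (μ := ProbabilityTheory.gaussianReal 0 1)
    ext t
    simp

/-! ### Construction of the transversal and conclusion -/

/-- There are at most continuum many measurable sets in a countably generated measurable space. -/
theorem MeasurableSpace.mk_measurableSet_le_continuum (α : Type*) [MeasurableSpace α]
    [h : MeasurableSpace.CountablyGenerated α] :
    Cardinal.mk {s : Set α // MeasurableSet s} ≤ Cardinal.continuum := by
  obtain ⟨b, hb, rfl⟩ := h.isCountablyGenerated
  exact MeasurableSpace.cardinal_measurableSet_le_continuum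
    (hb.le_aleph0.trans Cardinal.aleph0_le_continuum)

/-- An uncountable separable topological group has no isolated points. -/
theorem IsTopologicalGroup.nhdsNE_neBot_of_uncountable {G : Type*} [Group G] [TopologicalSpace G]
    [IsTopologicalGroup G] [TopologicalSpace.SeparableSpace G] [Uncountable G] (x : G) :
    (𝓝[≠] x).NeBot := by
  refine ⟨fun h => ?_⟩
  have hx : IsOpen ({x} : Set G) := (isOpen_singleton_iff_punctured_nhds x).2 h
  have h1 : IsOpen ({1} : Set G) := by
    convert hx.preimage (continuous_const_mul x)
    ext y
    simp
  have := discreteTopology_of_isOpen_singleton_one h1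
  exact not_countable (α := G) (TopologicalSpace.separableSpace_iff_countable.1 inferInstance)

/-- An uncountable locally compact Polish group has a Borel subgroup, uncountable and of uncountable
index, with a partial left transversal meeting all sets of positive Haar measure. -/
theorem exists_subgroup_transversal_inter_nonempty {G : Type*} [Group G] [TopologicalSpace G]
    [IsTopologicalGroup G] [PolishSpace G] [LocallyCompactSpace G] [MeasurableSpace G]
    [BorelSpace G] [Uncountable G] (μ : Measure G) [μ.IsHaarMeasure] :
    ∃ (H : Subgroup G) (X : Set G),
      MeasurableSet (H : Set G) ∧ Uncountable H ∧ Uncountable (G ⧸ H) ∧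
      IsPartialLeftTransversal H X ∧ ∀ B, MeasurableSet B → μ B ≠ 0 → (X ∩ B).Nonempty := by
  have hperf := IsTopologicalGroup.nhdsNE_neBot_of_uncountable (G := G)
  -- Non-isolation of 1 is what makes Haar measure atomless, by instance.
  have := hperf 1
  obtain ⟨S, hSc, h1, hinv, hSunc, hS⟩ :=
    exists_isCompact_uncountable_measure_pow_eq_zero hperf μ
  set H := Subgroup.iUnionPow S hinv
  have hpick := fun B : {B : Set G // MeasurableSet B ∧ μ B ≠ 0} =>
    exists_injective_mk_mem μ hSc h1 hinv hS B.2.1 B.2.2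
  have hcard : Cardinal.lift.{0} (Cardinal.mk {B : Set G // MeasurableSet B ∧ μ B ≠ 0}) ≤
      Cardinal.lift (Cardinal.mk (ℕ → Bool)) := by
    simp only [Cardinal.lift_uzero, Cardinal.mk_pi, Cardinal.mk_fintype, Fintype.card_bool,
      Nat.cast_ofNat, Cardinal.prod_const, Cardinal.mk_nat,
      Cardinal.two_power_aleph0, Cardinal.lift_continuum]
    exact (Cardinal.mk_subtype_mono fun B hB => hB.1).trans
      (MeasurableSpace.mk_measurableSet_le_continuum G)
  obtain ⟨e⟩ := Cardinal.lift_mk_le'.1 hcard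
  -- The representatives are cosets, chosen in the images of the sets B in G / H, and are lifted
  -- back to points of B afterwards.
  obtain ⟨f, hf, hfB⟩ := exists_injective_mem_of_mk_le
    (A := fun B : {B : Set G // MeasurableSet B ∧ μ B ≠ 0} => ((↑) : G → G ⧸ H) '' B.1) fun B => by
      obtain ⟨F, hF⟩ := hpick B
      exact ⟨fun i => ⟨_, F (e i), (F (e i)).2, rfl⟩, fun i j hij =>
        e.injective (hF (congrArg Subtype.val hij))⟩
  choose g hgB hgf using hfB
  refine ⟨H, range g, ?_, ?_, ?_, ?_, fun B hB hμB => ⟨g ⟨B, hB, hμB⟩, ⟨_, rfl⟩, hgB ⟨B, hB, hμB⟩⟩⟩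
  · exact MeasurableSet.iUnion fun n => (hSc.setPow n).measurableSet
  · have hSH : S ⊆ (H : Set G) := fun x hx => mem_iUnion.2 ⟨1, by simpa using hx⟩
    exact not_countable_iff.1 fun h => hSunc ((countable_coe_iff.1 h).mono hSH)
  -- Uncountable index is the case B = G of the coset count.
  · obtain ⟨F, hF⟩ := hpick ⟨univ, MeasurableSet.univ, NeZero.ne _⟩
    have : Uncountable (ℕ → Bool) := by
      rw [← Cardinal.aleph0_lt_mk_iff]
      simpa using Cardinal.cantor Cardinal.aleph0
    exact hF.uncountable
  · rintro a _ ⟨⟨B, rfl⟩, h, hh, hB⟩ _ ⟨⟨C, rfl⟩, k, hk, hC⟩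
    suffices B = C by rw [this]
    refine hf ?_
    rw [← hgf B, ← hgf C, ← hB, ← hC, QuotientGroup.mk_mul_of_mem a hh,
      QuotientGroup.mk_mul_of_mem a hk]

/-- A set meeting every measurable set of positive Haar measure has positive outer measure for
every Haar measure. -/
theorem measure_ne_zero_of_forall_inter_nonempty {G : Type*} [Group G] [TopologicalSpace G]
    [IsTopologicalGroup G] [LocallyCompactSpace G] [SecondCountableTopology G] [MeasurableSpace G]
    [BorelSpace G] (μ : Measure G) [μ.IsHaarMeasure] {X : Set G}
    (hX : ∀ B, MeasurableSet B → μ B ≠ 0 → (X ∩ B).Nonempty) (ν : Measure G) [ν.IsHaarMeasure] :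
    ν X ≠ 0 := by
  intro h
  have hν : ν (toMeasurable ν X)ᶜ ≠ 0 := fun h' => by
    have := measure_union_null ((measure_toMeasurable X).trans h) h'
    rw [union_compl_self] at this
    exact NeZero.ne _ this
  obtain ⟨x, hx, hx'⟩ := hX _ (measurableSet_toMeasurable ν X).compl
    fun h' => hν (Measure.absolutelyContinuous_isHaarMeasure ν μ h')
  exact hx' (subset_toMeasurable _ _ hx)

theorem theorem3p1 {G : Type*} [Group G] [TopologicalSpace G] [IsTopologicalGroup G]
    [PolishSpace G] [LocallyCompactSpace G] [MeasurableSpace G] [BorelSpace G]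
    [Uncountable G] :
    (∃ (H : Subgroup G) (X : Set G),
      MeasurableSet (H : Set G) ∧ Uncountable H ∧ Uncountable (G ⧸ H) ∧
      IsPartialLeftTransversal H X ∧
      NaivelyLeftHaarNull X ∧ ¬ HaarNull X ∧
      ∀ ν : Measure G, ν.IsHaarMeasure → ν X ≠ 0) ∧
    ((∀ a b : G, a * b = b * a) →
      ∃ (H : Subgroup G) (X : Set G),
        MeasurableSet (H : Set G) ∧ Uncountable H ∧ Uncountable (G ⧸ H) ∧
        IsPartialLeftTransversal H X ∧
        NaivelyHaarNull X ∧ ¬ HaarNull X ∧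
        ∀ ν : Measure G, ν.IsHaarMeasure → ν X ≠ 0) := by
  obtain ⟨H, X, hH, hHu, hGH, hX, hXB⟩ :=
    exists_subgroup_transversal_inter_nonempty (Measure.haar : Measure G)
  have hnull := hX.naivelyLeftHaarNull hH
  have hnot := not_haarNull_of_forall_inter_nonempty Measure.haar hXB
  have hpos : ∀ ν : Measure G, ν.IsHaarMeasure → ν X ≠ 0 := fun ν _ =>
    measure_ne_zero_of_forall_inter_nonempty Measure.haar hXB ν
  refine ⟨⟨H, X, hH, hHu, hGH, hX, hnull, hnot, hpos⟩,
    fun hcomm => ⟨H, X, hH, hHu, hGH, hX, ?_, hnot, hpos⟩⟩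
  obtain ⟨μ, hμ, hμX⟩ := hnull
  refine ⟨μ, hμ, fun g h => ?_⟩
  rw [← hμX (g * h)]
  congr 2
  funext x
  rw [mul_assoc, hcomm x h, ← mul_assoc]
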